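/- Write $e(x)=e^{2\pi i x}$. For real $\gamma,\kappa$, let $\psi(r,\gamma,\kappa)$ denote the meromorphic continuation to all $r\in\mathbb{C}$ of the series $$\psi(r,\gamma,\kappa)=\sum_{k\in\mathbb{Z},\,k>-\gamma}\frac{e((\gamma+k)\kappa)}{(\gamma+k)^r}\qquad(\operatorname{Re} r>1).$$ This continuation exists; it is holomorphic on $\mathbb{C}$ if $\kappa\notin\mathbb{Z}$ and on $\mathbb{C}\setminus\{1\}$ if $\kappa\in\mathbb{Z}$. For all $\gamma,\kappa\in\mathbb{R}$ one has, on the whole $r$-plane, $$\psi(r,\gamma,\kappa)=e(\gamma\kappa)\frac{\Gamma(1-r)}{(2\pi)^{1-r}}\Bigl\{e^{\pi i(1-r)/2}\,\psi(1-r,\kappa,-\gamma)+e^{-\pi i(1-r)/2}\,\psi(1-r,-\kappa,\gamma)\Bigr\}$$ as an identity of meromorphic functions: it holds pointwise at every $r$ with $r\notin\{1,2,3,\dots\}$ and, if $\gamma\in\mathbb{Z}$, also $r\neq 0$ (that is, wherever every factor on the right is finite); and at every point $r_0$ (with $r_0\ne 1$ if $\kappa\in\mathbb{Z}$) the right-hand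 side tends to $\psi(r_0,\gamma,\kappa)$ as $r\to r_0$, $r\neq r_0$. -/

import Mathlib

open Filter Topology

noncomputable section

namespace LerchZeta

/-- The standard notation `e(s) = exp(2πis)`. -/
def e (s : ℂ) : ℂ := Complex.exp (2 * Real.pi * Complex.I * s)

/-- `f` is the meromorphic continuation to all of `ℂ` (as a function of `r`) of the absolutely
convergent series `∑_{k ∈ ℤ, k > -γ} e((γ + k)κ) / (γ + k)^r`, `Re r > 1`. The normal form only
says that removable singularities have been removed and that `f` takes the value `0` at its poles;
it makes `f` unique. -/
structure IsLerchPsi (γ κ : ℝ) (f : ℂ → ℂ) : Prop where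
  meromorphic : MeromorphicNFOn f Set.univ
  hasSum : ∀ r : ℂ, 1 < r.re →
    HasSum (fun k : {k : ℤ // -γ < (k : ℝ)} =>
      e (((γ + (k : ℤ)) * κ : ℝ) : ℂ) / ((γ + (k : ℤ) : ℝ) : ℂ) ^ r) (f r)

/-- The function `ψ(r, γ, κ)`: the continuation described by `IsLerchPsi`. -/
def lerchPsi (r : ℂ) (γ κ : ℝ) : ℂ := Classical.epsilon (IsLerchPsi γ κ) r

end LerchZeta

end

/-! The sum over `k > -γ` is half the sum of the two bilateral series `∑ e((n + γ)κ) |n + γ|^(-r)`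
and `∑ sgn(n + γ) e((n + γ)κ) |n + γ|^(-r)`. Each of these is, up to a Gamma factor, the Mellin
transform of a theta series with characteristics `(γ, κ)`, and Jacobi's inversion formula
exchanges `(γ, κ)` with `(-κ, γ)`; so Riemann's argument for `ζ` continues both series and gives
them functional equations, with factors `cos (π(1 - r)/2)` and `-i sin (π(1 - r)/2)` respectively.
The even series is invariant and the odd one changes sign under `(γ, κ) ↦ (-γ, -κ)`, so on adding
the two equations the cosine and the sine recombine into the exponentials `e^{±πi(1 - r)/2}`.
Finally, a meromorphic function in normal form is determined by its values on a half-plane, which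
identifies `ψ` with the continuation so constructed. -/

noncomputable section

open Complex Set Asymptotics
open scoped Real

namespace LerchZeta

lemma eventually_nhdsNE_forall_ne_intCast (z₀ : ℂ) : ∀ᶠ z : ℂ in 𝓝[≠] z₀, ∀ n : ℤ, z ≠ n := by
  have hclosed : IsClosed ((fun n : ℤ ↦ (n : ℂ)) '' {n | (n : ℂ) ≠ z₀}) :=
    Complex.isClosedEmbedding_intCast.isClosedMap _ (isClosed_discrete _)
  filter_upwards [nhdsWithin_le_nhds (hclosed.isOpen_compl.mem_nhds (x := z₀) (by simp)),
    self_mem_nhdsWithin] with z hz hne n hn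
  exact hz ⟨n, by simpa [← hn] using hne, hn.symm⟩

lemma eqOn_of_meromorphicNFOn_of_eventuallyEq_nhdsNE {𝕜 E : Type*} [NontriviallyNormedField 𝕜]
    [NormedAddCommGroup E] [NormedSpace 𝕜 E] {f g : 𝕜 → E} {U : Set 𝕜}
    (hf : MeromorphicNFOn f U) (hg : MeromorphicNFOn g U) (hU : IsPreconnected U) {z : 𝕜}
    (hz : z ∈ U) (h : f =ᶠ[𝓝[≠] z] g) : EqOn f g U := by
  have hfg : MeromorphicOn (f - g) U := hf.meromorphicOn.sub hg.meromorphicOn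
  have order_z : meromorphicOrderAt (f - g) z = ⊤ :=
    meromorphicOrderAt_eq_top_iff.mpr (h.mono fun _ hw ↦ sub_eq_zero.mpr hw)
  intro w hw
  have order_w : meromorphicOrderAt (f - g) w = ⊤ := by
    by_contra hne
    exact hfg.meromorphicOrderAt_ne_top_of_isPreconnected hU hw hz hne order_z
  have eventually_w : f =ᶠ[𝓝[≠] w] g :=
    (meromorphicOrderAt_eq_top_iff.mp order_w).mono fun _ hv ↦ sub_eq_zero.mp hv
  exact ((hf hw).eventuallyEq_nhdsNE_iff_eventuallyEq_nhds (hg hw)).mp eventually_w |>.eq_of_nhds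

lemma one_div_neg_I_mul_I_mul_one_div_cpow {x : ℝ} (hx : 0 < x) (s : ℂ) :
    1 / (-I * (I * (1 / x : ℝ))) ^ s = (x : ℂ) ^ s := by
  rw [← mul_assoc, neg_mul, I_mul_I, neg_neg, one_mul, one_div x, ofReal_inv,
    inv_cpow _ _ (by rw [arg_ofReal_of_nonneg hx.le]; exact Real.pi_ne_zero.symm), one_div, inv_inv]

lemma one_div_half_mul_Gammaℝ_inv {s : ℂ} (hs : s ≠ 0) :
    1 / (s / 2) * (Gammaℝ s)⁻¹ = (Gammaℝ (s + 2))⁻¹ / π := by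
  have hπ : (π : ℂ) ≠ 0 := ofReal_ne_zero.mpr Real.pi_ne_zero
  rw [Gammaℝ_add_two hs]
  field_simp

lemma e_add (s t : ℂ) : e (s + t) = e s * e t := by
  rw [e, e, e, mul_add, Complex.exp_add]

lemma e_neg (s : ℂ) : e (-s) = (e s)⁻¹ := by
  rw [e, e, ← Complex.exp_neg, mul_neg]

lemma e_ne_zero (s : ℂ) : e s ≠ 0 := Complex.exp_ne_zero _

lemma norm_e_ofReal (x : ℝ) : ‖e x‖ = 1 := by
  rw [e, show 2 * π * I * (x : ℂ) = ((2 * π * x : ℝ) : ℂ) * I by push_cast; ring]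
  exact norm_exp_ofReal_mul_I _

lemma e_sq_mul_I_mul_div_two (x t : ℝ) : e (x ^ 2 * (I * t) / 2) = rexp (-π * x ^ 2 * t) := by
  rw [e, ofReal_exp]
  congr 1
  push_cast
  linear_combination π * x ^ 2 * t * I_sq

/-! ### Theta functions with characteristics -/

/-- The theta function with characteristics `∑ₙ e((n + γ)κ) e((n + γ)²τ/2)`, in terms of the
Jacobi theta function. -/
def thetaChar (γ κ τ : ℂ) : ℂ :=
  e (γ * κ + γ ^ 2 * τ / 2) * jacobiTheta₂ (κ + γ * τ) τ

/-- The series `∑ₙ (n + γ) e((n + γ)κ) e((n + γ)²τ/2)`, which is `(2πi)⁻¹ ∂/∂κ` of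
`thetaChar γ κ τ`. -/
def thetaChar' (γ κ τ : ℂ) : ℂ :=
  e (γ * κ + γ ^ 2 * τ / 2) *
    (jacobiTheta₂' (κ + γ * τ) τ / (2 * π * I) + γ * jacobiTheta₂ (κ + γ * τ) τ)

lemma e_mul_jacobiTheta₂_term (γ κ τ : ℂ) (n : ℤ) :
    e (γ * κ + γ ^ 2 * τ / 2) * jacobiTheta₂_term n (κ + γ * τ) τ =
      e ((n + γ) * κ) * e ((n + γ) ^ 2 * τ / 2) := by
  rw [jacobiTheta₂_term, e, e, e, ← Complex.exp_add, ← Complex.exp_add]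
  ring_nf

lemma hasSum_thetaChar (γ κ : ℂ) {τ : ℂ} (hτ : 0 < τ.im) :
    HasSum (fun n : ℤ ↦ e ((n + γ) * κ) * e ((n + γ) ^ 2 * τ / 2)) (thetaChar γ κ τ) := by
  simp_rw [← e_mul_jacobiTheta₂_term]
  exact (hasSum_jacobiTheta₂_term _ hτ).mul_left _

lemma hasSum_thetaChar' (γ κ : ℂ) {τ : ℂ} (hτ : 0 < τ.im) :
    HasSum (fun n : ℤ ↦ e ((n + γ) * κ) * (n + γ) * e ((n + γ) ^ 2 * τ / 2))
      (thetaChar' γ κ τ) := by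
  have hθ := hasSum_jacobiTheta₂_term (κ + γ * τ) hτ
  have hθ' := hasSum_jacobiTheta₂'_term (κ + γ * τ) hτ
  refine (((hθ'.div_const (2 * π * I)).add (hθ.mul_left γ)).mul_left _).congr_fun fun n ↦ ?_
  rw [mul_right_comm, ← e_mul_jacobiTheta₂_term, jacobiTheta₂'_term, mul_assoc (2 * π * I),
    mul_div_cancel_left₀ _ two_pi_I_ne_zero]
  ring

lemma thetaChar_neg_neg (γ κ τ : ℂ) : thetaChar (-γ) (-κ) τ = thetaChar γ κ τ := by
  rw [thetaChar, thetaChar, ← jacobiTheta₂_neg_left]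
  ring_nf

lemma thetaChar'_neg_neg (γ κ τ : ℂ) : thetaChar' (-γ) (-κ) τ = -thetaChar' γ κ τ := by
  rw [thetaChar', thetaChar', show -κ + -γ * τ = -(κ + γ * τ) by ring, jacobiTheta₂_neg_left,
    jacobiTheta₂'_neg_left]
  ring_nf

lemma continuousAt_thetaChar (γ κ : ℂ) {τ : ℂ} (hτ : 0 < τ.im) :
    ContinuousAt (thetaChar γ κ) τ := by
  refine .mul (by unfold e; fun_prop) ?_
  exact (continuousAt_jacobiTheta₂ (κ + γ * τ) hτ).comp (f := fun τ ↦ (κ + γ * τ, τ))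
    (by fun_prop)

lemma continuousAt_thetaChar' (γ κ : ℂ) {τ : ℂ} (hτ : 0 < τ.im) :
    ContinuousAt (thetaChar' γ κ) τ := by
  have hpair : ContinuousAt (fun τ ↦ (κ + γ * τ, τ)) τ := by fun_prop
  have hθ := (continuousAt_jacobiTheta₂ (κ + γ * τ) hτ).comp (f := fun τ ↦ (κ + γ * τ, τ)) hpair
  have hθ' := (continuousAt_jacobiTheta₂' (κ + γ * τ) hτ).comp (f := fun τ ↦ (κ + γ * τ, τ)) hpair
  exact .mul (by unfold e; fun_prop) ((hθ'.div_const _).add (hθ.const_mul γ))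

lemma e_mul_cexp_neg_sq_div (γ κ : ℂ) {τ : ℂ} (hτ : τ ≠ 0) :
    e (γ * κ + γ ^ 2 * τ / 2) * cexp (-π * I * (κ + γ * τ) ^ 2 / τ) =
      e (γ * κ) * e (-κ * γ + (-κ) ^ 2 * (-1 / τ) / 2) := by
  rw [← e_add, e, e, ← Complex.exp_add]
  congr 1
  field_simp
  ring

lemma add_mul_div_self_eq (γ κ : ℂ) {τ : ℂ} (hτ : τ ≠ 0) :
    (κ + γ * τ) / τ = γ + -κ * (-1 / τ) := by
  field_simp
  ring

theorem thetaChar_functional_equation (γ κ : ℂ) {τ : ℂ} (hτ : τ ≠ 0) :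
    thetaChar γ κ τ =
      e (γ * κ) * (1 / (-I * τ) ^ (1 / 2 : ℂ)) * thetaChar (-κ) γ (-1 / τ) := by
  rw [thetaChar, jacobiTheta₂_functional_equation, thetaChar, add_mul_div_self_eq γ κ hτ]
  linear_combination 1 / (-I * τ) ^ (1 / 2 : ℂ) *
    jacobiTheta₂ (γ + -κ * (-1 / τ)) (-1 / τ) * e_mul_cexp_neg_sq_div γ κ hτ

theorem thetaChar'_functional_equation (γ κ : ℂ) {τ : ℂ} (hτ : τ ≠ 0) :
    thetaChar' γ κ τ =
      e (γ * κ) * (1 / (-I * τ) ^ (1 / 2 : ℂ)) / τ * thetaChar' (-κ) γ (-1 / τ) := by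
  rw [thetaChar', jacobiTheta₂'_functional_equation, jacobiTheta₂_functional_equation (κ + γ * τ),
    thetaChar', add_mul_div_self_eq γ κ hτ]
  set θ := jacobiTheta₂ (γ + -κ * (-1 / τ)) (-1 / τ)
  set θ' := jacobiTheta₂' (γ + -κ * (-1 / τ)) (-1 / τ)
  set p := 1 / (-I * τ) ^ (1 / 2 : ℂ)
  have hderiv (E : ℂ) :
      p * E / τ * (θ' - 2 * π * I * (κ + γ * τ) * θ) / (2 * π * I) + γ * (p * E * θ) =
        E * (p / τ * (θ' / (2 * π * I) + -κ * θ)) := by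
    have := two_pi_I_ne_zero
    field_simp
    ring
  rw [hderiv, ← mul_assoc, e_mul_cexp_neg_sq_div γ κ hτ]
  ring

/-! ### Theta kernels on the imaginary axis -/

lemma hasSum_thetaChar_I_mul (γ κ : ℝ) {t : ℝ} (ht : 0 < t) :
    HasSum (fun n : ℤ ↦ e (((n + γ) * κ : ℝ) : ℂ) * rexp (-π * (n + γ) ^ 2 * t))
      (thetaChar γ κ (I * t)) := by
  refine (hasSum_thetaChar γ κ (by simpa)).congr_fun fun n ↦ ?_
  rw [← e_sq_mul_I_mul_div_two]
  push_cast
  rfl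

lemma hasSum_thetaChar'_I_mul (γ κ : ℝ) {t : ℝ} (ht : 0 < t) :
    HasSum (fun n : ℤ ↦ e (((n + γ) * κ : ℝ) : ℂ) * ((n + γ : ℝ) : ℂ) *
      rexp (-π * (n + γ) ^ 2 * t)) (thetaChar' γ κ (I * t)) := by
  refine (hasSum_thetaChar' γ κ (by simpa)).congr_fun fun n ↦ ?_
  rw [← e_sq_mul_I_mul_div_two]
  push_cast
  rfl

/-- The limit of `thetaChar γ κ (I * t)` as `t → ∞`: the contribution of the index `n = -γ`,
present exactly when `γ` is an integer. -/
def thetaConst (γ : ℝ) : ℂ := if (γ : UnitAddCircle) = 0 then 1 else 0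

lemma coe_unitAddCircle_eq_zero_iff {γ : ℝ} : (γ : UnitAddCircle) = 0 ↔ ∃ m : ℤ, γ = m := by
  rw [AddCircle.coe_eq_zero_iff]
  simp [eq_comm]

lemma thetaConst_neg (γ : ℝ) : thetaConst (-γ) = thetaConst γ := by
  simp [thetaConst]

lemma thetaConst_eq_zero {γ : ℝ} (h : ∀ m : ℤ, γ ≠ m) : thetaConst γ = 0 :=
  if_neg fun hγ ↦ let ⟨m, hm⟩ := coe_unitAddCircle_eq_zero_iff.mp hγ; h m hm

lemma hasSum_thetaChar_I_mul_sub_thetaConst (γ κ : ℝ) {t : ℝ} (ht : 0 < t) :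
    HasSum (fun n : ℤ ↦ if n + γ = 0 then 0 else
      e (((n + γ) * κ : ℝ) : ℂ) * rexp (-π * (n + γ) ^ 2 * t))
      (thetaChar γ κ (I * t) - thetaConst γ) := by
  classical
  have key := hasSum_thetaChar_I_mul γ κ ht
  rw [thetaConst]
  split_ifs with hγ
  · obtain ⟨k, rfl⟩ := coe_unitAddCircle_eq_zero_iff.mp hγ
    simpa [← Int.cast_add, add_eq_zero_iff_eq_neg, e] using hasSum_ite_sub_hasSum key (-k)
  · have hne (n : ℤ) : n + γ ≠ 0 := by
      contrapose! hγ
      exact coe_unitAddCircle_eq_zero_iff.mpr ⟨-n, by push_cast; linarith⟩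
    simpa [hne] using key

lemma isBigO_thetaChar_I_mul_sub_thetaConst (γ κ r : ℝ) :
    (fun t : ℝ ↦ thetaChar γ κ (I * t) - thetaConst γ) =O[atTop] (· ^ r : ℝ → ℝ) := by
  obtain ⟨p, hp, hdecay⟩ := HurwitzZeta.isBigO_atTop_evenKernel_sub γ
  refine (IsBigO.trans (.of_norm_eventuallyLE ?_) hdecay).trans
    (isLittleO_exp_neg_mul_rpow_atTop hp r).isBigO
  filter_upwards [eventually_gt_atTop 0] with t ht
  rw [← (hasSum_thetaChar_I_mul_sub_thetaConst γ κ ht).tsum_eq]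
  refine tsum_of_norm_bounded (HurwitzZeta.hasSum_int_evenKernel₀ γ ht) fun n ↦ ?_
  split_ifs
  · simp
  · rw [norm_mul, norm_e_ofReal, one_mul, norm_real, Real.norm_of_nonneg (Real.exp_pos _).le]

lemma isBigO_thetaChar'_I_mul (γ κ r : ℝ) :
    (fun t : ℝ ↦ thetaChar' γ κ (I * t)) =O[atTop] (· ^ r : ℝ → ℝ) := by
  obtain ⟨p, hp, hdecay⟩ := HurwitzKernelBounds.isBigO_atTop_F_int_one γ
  refine (IsBigO.trans (.of_norm_eventuallyLE ?_) hdecay).trans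
    (isLittleO_exp_neg_mul_rpow_atTop hp r).isBigO
  filter_upwards [eventually_gt_atTop 0] with t ht
  rw [← (hasSum_thetaChar'_I_mul γ κ ht).tsum_eq]
  refine tsum_of_norm_bounded (HurwitzKernelBounds.summable_f_int 1 γ ht).hasSum fun n ↦ ?_
  rw [norm_mul, norm_mul, norm_e_ofReal, one_mul, norm_real, norm_real,
    Real.norm_of_nonneg (Real.exp_pos _).le, Real.norm_eq_abs, HurwitzKernelBounds.f_int, pow_one]

lemma locallyIntegrableOn_comp_I_mul {f : ℂ → ℂ} (hf : ∀ τ : ℂ, 0 < τ.im → ContinuousAt f τ) :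
    MeasureTheory.LocallyIntegrableOn (fun t : ℝ ↦ f (I * t)) (Ioi 0) := by
  refine ContinuousOn.locallyIntegrableOn (fun t ht ↦ ?_) measurableSet_Ioi
  have ht' : 0 < (I * t).im := by simpa using ht
  exact ((hf _ ht').comp (f := fun t : ℝ ↦ I * t) (by fun_prop)).continuousWithinAt

lemma neg_one_div_I_mul_one_div (x : ℝ) : -1 / (I * (1 / x : ℝ)) = I * x := by
  simp [div_eq_mul_inv, mul_comm]

lemma thetaChar_I_mul_one_div (γ κ : ℝ) {x : ℝ} (hx : 0 < x) :
    thetaChar γ κ (I * (1 / x : ℝ)) =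
      e ((γ * κ : ℝ) : ℂ) * ((x ^ (1 / 2 : ℝ) : ℝ) : ℂ) * thetaChar (-κ : ℝ) γ (I * x) := by
  have hτ : I * (1 / x : ℝ) ≠ 0 := mul_ne_zero I_ne_zero (ofReal_ne_zero.mpr (by positivity))
  rw [thetaChar_functional_equation γ κ hτ, one_div_neg_I_mul_I_mul_one_div_cpow hx,
    neg_one_div_I_mul_one_div, ofReal_cpow hx.le]
  push_cast
  rfl

lemma thetaChar'_I_mul_one_div (γ κ : ℝ) {x : ℝ} (hx : 0 < x) :
    thetaChar' γ κ (I * (1 / x : ℝ)) =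
      -I * e ((γ * κ : ℝ) : ℂ) * ((x ^ (3 / 2 : ℝ) : ℝ) : ℂ) * thetaChar' (-κ : ℝ) γ (I * x) := by
  have hτ : I * (1 / x : ℝ) ≠ 0 := mul_ne_zero I_ne_zero (ofReal_ne_zero.mpr (by positivity))
  have hτ_inv : (I * (1 / x : ℝ))⁻¹ = -I * x := by simp [mul_comm]
  have hpow : x ^ (3 / 2 : ℝ) = x ^ (1 / 2 : ℝ) * x := by
    rw [← Real.rpow_add_one hx.ne']
    norm_num
  rw [thetaChar'_functional_equation γ κ hτ, one_div_neg_I_mul_I_mul_one_div_cpow hx,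
    neg_one_div_I_mul_one_div, div_eq_mul_inv, hτ_inv, hpow, ofReal_mul (x ^ _),
    ofReal_cpow hx.le]
  push_cast
  ring

/-- The even kernels for `(γ, κ)` and `(-κ, γ)`, exchanged by `t ↦ 1 / t`; their Mellin transform
is the completed even zeta function. -/
@[simps]
def evenFEPair (γ κ : ℝ) : WeakFEPair ℂ where
  f t := thetaChar γ κ (I * t)
  g t := thetaChar (-κ : ℝ) γ (I * t)
  hf_int := locallyIntegrableOn_comp_I_mul fun _ ↦ continuousAt_thetaChar _ _
  hg_int := locallyIntegrableOn_comp_I_mul fun _ ↦ continuousAt_thetaChar _ _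
  k := 1 / 2
  hk := one_half_pos
  ε := e ((γ * κ : ℝ) : ℂ)
  hε := e_ne_zero _
  f₀ := thetaConst γ
  g₀ := thetaConst (-κ)
  hf_top := isBigO_thetaChar_I_mul_sub_thetaConst γ κ
  hg_top := isBigO_thetaChar_I_mul_sub_thetaConst (-κ) γ
  h_feq _ hx := thetaChar_I_mul_one_div γ κ (mem_Ioi.mp hx)

/-- The odd kernels for `(γ, κ)` and `(-κ, γ)`, exchanged by `t ↦ 1 / t`; their Mellin transform
is the completed odd zeta function. -/
@[simps]
def oddFEPair (γ κ : ℝ) : WeakFEPair ℂ where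
  f t := thetaChar' γ κ (I * t)
  g t := thetaChar' (-κ : ℝ) γ (I * t)
  hf_int := locallyIntegrableOn_comp_I_mul fun _ ↦ continuousAt_thetaChar' _ _
  hg_int := locallyIntegrableOn_comp_I_mul fun _ ↦ continuousAt_thetaChar' _ _
  k := 3 / 2
  hk := by norm_num
  ε := -I * e ((γ * κ : ℝ) : ℂ)
  hε := mul_ne_zero (neg_ne_zero.mpr I_ne_zero) (e_ne_zero _)
  f₀ := 0
  g₀ := 0
  hf_top r := by simpa only [sub_zero] using isBigO_thetaChar'_I_mul γ κ r
  hg_top r := by simpa only [sub_zero] using isBigO_thetaChar'_I_mul (-κ) γ r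
  h_feq _ hx := thetaChar'_I_mul_one_div γ κ (mem_Ioi.mp hx)

lemma isStrongFEPair_oddFEPair (γ κ : ℝ) : IsStrongFEPair (oddFEPair γ κ) := ⟨rfl, rfl⟩

lemma evenFEPair_symm (γ κ : ℝ) : (evenFEPair γ κ).symm = evenFEPair (-κ) γ := by
  unfold evenFEPair WeakFEPair.symm
  congr 1
  · simp [thetaChar_neg_neg]
  · rw [← e_neg, ← ofReal_neg, neg_mul, mul_comm]
  · exact (thetaConst_neg γ).symm

lemma evenFEPair_neg_neg (γ κ : ℝ) : evenFEPair (-γ) (-κ) = evenFEPair γ κ := by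
  unfold evenFEPair
  congr 1
  · simp [thetaChar_neg_neg]
  · funext t
    simpa using thetaChar_neg_neg (-κ) γ (I * t)
  · rw [neg_mul_neg]
  · exact thetaConst_neg γ
  · exact thetaConst_neg (-κ)

lemma oddFEPair_symm_Λ (γ κ : ℝ) : (oddFEPair γ κ).symm.Λ = (oddFEPair (-κ) γ).Λ := by
  rw [(isStrongFEPair_oddFEPair γ κ).symm_Λ_eq, (isStrongFEPair_oddFEPair (-κ) γ).Λ_eq]
  rfl

lemma oddFEPair_neg_neg_Λ (γ κ : ℝ) (s : ℂ) :
    (oddFEPair (-γ) (-κ)).Λ s = -(oddFEPair γ κ).Λ s := by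
  rw [(isStrongFEPair_oddFEPair (-γ) (-κ)).Λ_eq, (isStrongFEPair_oddFEPair γ κ).Λ_eq]
  have hf : (oddFEPair (-γ) (-κ)).f = fun t ↦ (-1 : ℂ) • (oddFEPair γ κ).f t := by
    funext t
    rw [oddFEPair_f, oddFEPair_f, ofReal_neg, ofReal_neg, thetaChar'_neg_neg, neg_one_smul]
  rw [hf, mellin_const_smul, neg_one_smul]

/-! ### The bilateral zeta functions -/

/-- The meromorphic continuation of `∑_{n ∈ ℤ, n + γ ≠ 0} e((n + γ)κ) / |n + γ|^s`. This is
`Λ(s / 2) / Gammaℝ s`, where `Λ` is the Mellin transform of the even kernel; it is written out in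
terms of the entire part `Λ₀` of `Λ`, so that the value at `s = 0` is the limit. -/
def evenZeta (γ κ : ℝ) (s : ℂ) : ℂ :=
  ((evenFEPair γ κ).Λ₀ (s / 2) - e ((γ * κ : ℝ) : ℂ) / (1 / 2 - s / 2) * thetaConst (-κ)) *
    (Gammaℝ s)⁻¹ - thetaConst γ * ((Gammaℝ (s + 2))⁻¹ / π)

/-- The entire continuation of `∑_{n ∈ ℤ} sgn(n + γ) e((n + γ)κ) / |n + γ|^s`. -/
def oddZeta (γ κ : ℝ) (s : ℂ) : ℂ :=
  (oddFEPair γ κ).Λ ((s + 1) / 2) * (Gammaℝ (s + 1))⁻¹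

lemma evenZeta_eq {γ : ℝ} (κ : ℝ) {s : ℂ} (hs : s ≠ 0 ∨ thetaConst γ = 0) :
    evenZeta γ κ s = (evenFEPair γ κ).Λ (s / 2) * (Gammaℝ s)⁻¹ := by
  simp only [evenZeta, WeakFEPair.Λ, evenFEPair_f₀, evenFEPair_g₀, evenFEPair_k, evenFEPair_ε,
    smul_eq_mul]
  push_cast
  rcases hs with hs | hs
  · linear_combination thetaConst γ * one_div_half_mul_Gammaℝ_inv hs
  · rw [hs]
    ring

lemma differentiable_evenFEPair_Λ₀_div_two (γ κ : ℝ) :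
    Differentiable ℂ fun s ↦ (evenFEPair γ κ).Λ₀ (s / 2) :=
  (evenFEPair γ κ).differentiable_Λ₀.comp (differentiable_id.div_const 2)

lemma differentiable_Gammaℝ_add_inv (a : ℂ) : Differentiable ℂ fun s ↦ (Gammaℝ (s + a))⁻¹ :=
  differentiable_Gammaℝ_inv.comp (differentiable_id.add_const a)

lemma differentiableAt_evenZeta (γ : ℝ) {κ : ℝ} {s : ℂ} (hs : s ≠ 1 ∨ thetaConst κ = 0) :
    DifferentiableAt ℂ (evenZeta γ κ) s := by
  have hpole : DifferentiableAt ℂ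
      (fun s ↦ e ((γ * κ : ℝ) : ℂ) / (1 / 2 - s / 2) * thetaConst (-κ)) s := by
    rcases hs with hs | hs
    · have hne : 1 / 2 - s / 2 ≠ 0 := fun h ↦ hs (by linear_combination -2 * h)
      fun_prop (disch := exact hne)
    · simp [thetaConst_neg, hs]
  exact .sub (((differentiable_evenFEPair_Λ₀_div_two γ κ s).sub hpole).mul
    (differentiable_Gammaℝ_inv s)) (((differentiable_Gammaℝ_add_inv 2 s).div_const _).const_mul _)

lemma differentiable_oddZeta (γ κ : ℝ) : Differentiable ℂ (oddZeta γ κ) :=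
  .mul ((isStrongFEPair_oddFEPair γ κ).differentiable_Λ.comp
    ((differentiable_id.add_const 1).div_const 2)) (differentiable_Gammaℝ_add_inv 1)

lemma meromorphicAt_evenZeta (γ κ : ℝ) (s : ℂ) : MeromorphicAt (evenZeta γ κ) s := by
  have hΛ₀ := ((differentiable_evenFEPair_Λ₀_div_two γ κ).analyticAt s).meromorphicAt
  have hΓ := (differentiable_Gammaℝ_inv.analyticAt s).meromorphicAt
  have hΓ₂ := ((differentiable_Gammaℝ_add_inv 2).analyticAt s).meromorphicAt
  unfold evenZeta
  fun_prop

lemma evenZeta_neg_neg (γ κ : ℝ) (s : ℂ) : evenZeta (-γ) (-κ) s = evenZeta γ κ s := by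
  simp [evenZeta, evenFEPair_neg_neg, thetaConst_neg]

lemma oddZeta_neg_neg (γ κ : ℝ) (s : ℂ) : oddZeta (-γ) (-κ) s = -oddZeta γ κ s := by
  simp [oddZeta, oddFEPair_neg_neg_Λ]

lemma summable_norm_e_div_abs_rpow (γ κ : ℝ) {x : ℝ} (hx : 1 < x) :
    Summable fun n : ℤ ↦ ‖e (((n + γ) * κ : ℝ) : ℂ)‖ / |n + γ| ^ x := by
  simp_rw [norm_e_ofReal]
  exact (Real.summable_one_div_int_add_rpow γ x).mpr hx

lemma hasSum_evenZeta (γ κ : ℝ) {s : ℂ} (hs : 1 < s.re) :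
    HasSum (fun n : ℤ ↦ e (((n + γ) * κ : ℝ) : ℂ) / (|n + γ| : ℝ) ^ s) (evenZeta γ κ s) := by
  have hs_pos : 0 < s.re := zero_lt_one.trans hs
  have hk : (evenFEPair γ κ).k < (s / 2).re := by
    rw [div_ofNat_re, evenFEPair_k]
    linarith
  have hmellin := hasSum_mellin_pi_mul_sq hs_pos
    (fun t ht ↦ hasSum_thetaChar_I_mul_sub_thetaConst γ κ ht) (summable_norm_e_div_abs_rpow γ κ hs)
  have hΛ := ((evenFEPair γ κ).hasMellin hk).2
  simp only [evenFEPair_f, evenFEPair_f₀] at hΛ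
  rw [hΛ] at hmellin
  rw [evenZeta_eq κ (.inl (ne_zero_of_re_pos hs_pos))]
  refine (hmellin.mul_right (Gammaℝ s)⁻¹).congr_fun fun n ↦ ?_
  have := Gammaℝ_ne_zero_of_re_pos hs_pos
  field_simp

lemma hasSum_oddZeta (γ κ : ℝ) {s : ℂ} (hs : 1 < s.re) :
    HasSum (fun n : ℤ ↦ e (((n + γ) * κ : ℝ) : ℂ) * SignType.sign (n + γ : ℝ) /
      (|n + γ| : ℝ) ^ s) (oddZeta γ κ s) := by
  have hs_pos : 0 < s.re := zero_lt_one.trans hs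
  have hmellin := hasSum_mellin_pi_mul_sq' hs_pos
    (fun t ht ↦ hasSum_thetaChar'_I_mul γ κ ht) (summable_norm_e_div_abs_rpow γ κ hs)
  rw [oddZeta, (isStrongFEPair_oddFEPair γ κ).Λ_eq]
  refine (hmellin.mul_right (Gammaℝ (s + 1))⁻¹).congr_fun fun n ↦ ?_
  have : Gammaℝ (s + 1) ≠ 0 := Gammaℝ_ne_zero_of_re_pos (by rw [add_re, one_re]; linarith)
  field_simp

theorem evenZeta_functional_equation {γ : ℝ} (κ : ℝ) {r : ℂ} (hr : ∀ n : ℕ, r ≠ n + 1)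
    (hr₀ : r ≠ 0 ∨ thetaConst γ = 0) :
    evenZeta γ κ r = e ((γ * κ : ℝ) : ℂ) * Gammaℂ (1 - r) * cos (π * (1 - r) / 2) *
      evenZeta (-κ) γ (1 - r) := by
  have hr₁ : 1 - r ≠ 0 := sub_ne_zero.mpr (by simpa using (hr 0).symm)
  have hΓ := inv_Gammaℝ_one_sub (s := 1 - r) fun n h ↦ hr n (by linear_combination -h)
  have hΛ := (evenFEPair γ κ).functional_equation ((1 - r) / 2)
  rw [evenFEPair_symm, evenFEPair_k, evenFEPair_ε, smul_eq_mul,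
    show (((1 / 2 : ℝ) : ℂ) - (1 - r) / 2) = r / 2 by push_cast; ring] at hΛ
  rw [sub_sub_cancel] at hΓ
  rw [evenZeta_eq κ hr₀, evenZeta_eq γ (.inl hr₁), hΓ, hΛ]
  ring

theorem oddZeta_functional_equation (γ κ : ℝ) {r : ℂ} (hr : ∀ n : ℕ, r ≠ n + 1) :
    oddZeta γ κ r = -I * e ((γ * κ : ℝ) : ℂ) * Gammaℂ (1 - r) * sin (π * (1 - r) / 2) *
      oddZeta (-κ) γ (1 - r) := by
  have hΓ := inv_Gammaℝ_two_sub (s := 1 - r) fun n h ↦ hr n (by linear_combination -h)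
  have hΛ := (oddFEPair γ κ).functional_equation ((1 - r + 1) / 2)
  rw [oddFEPair_symm_Λ, oddFEPair_k, oddFEPair_ε, smul_eq_mul,
    show (((3 / 2 : ℝ) : ℂ) - (1 - r + 1) / 2) = (r + 1) / 2 by push_cast; ring] at hΛ
  rw [show 2 - (1 - r) = r + 1 by ring] at hΓ
  rw [oddZeta, oddZeta, hΓ, hΛ]
  ring

/-! ### The Lerch function -/

/-- The Lerch function `ψ(s, γ, κ)` away from its possible pole, where it takes a junk value. Under
half the sum of the even and odd series the terms with `n + γ < 0` cancel. -/
def lerchZeta (γ κ : ℝ) (s : ℂ) : ℂ := (evenZeta γ κ s + oddZeta γ κ s) / 2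

lemma hasSum_lerchZeta (γ κ : ℝ) {s : ℂ} (hs : 1 < s.re) :
    HasSum (fun k : {k : ℤ // -γ < (k : ℝ)} ↦
      e (((γ + (k : ℤ)) * κ : ℝ) : ℂ) / ((γ + (k : ℤ) : ℝ) : ℂ) ^ s) (lerchZeta γ κ s) := by
  have hs₀ : s ≠ 0 := ne_zero_of_re_pos (zero_lt_one.trans hs)
  have hbilateral := ((hasSum_evenZeta γ κ hs).add (hasSum_oddZeta γ κ hs)).div_const 2
  refine (hasSum_subtype_iff_indicator (s := {k : ℤ | -γ < (k : ℝ)})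
    (f := fun k : ℤ ↦ e (((γ + k) * κ : ℝ) : ℂ) / ((γ + k : ℝ) : ℂ) ^ s)).mpr
    (hbilateral.congr_fun fun n ↦ ?_)
  simp only [indicator_apply, mem_ofPred_eq]
  rcases lt_trichotomy (n + γ : ℝ) 0 with hn | hn | hn
  · rw [if_neg (by linarith), sign_neg hn, SignType.coe_neg_one]
    ring
  · rw [if_neg (by linarith), hn]
    simp [zero_cpow hs₀]
  · rw [if_pos (by linarith), sign_pos hn, abs_of_pos hn, add_comm γ, SignType.coe_one]
    ring

lemma analyticAt_lerchZeta (γ : ℝ) {κ : ℝ} {s : ℂ} (hs : s ≠ 1 ∨ ∀ m : ℤ, κ ≠ m) :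
    AnalyticAt ℂ (lerchZeta γ κ) s := by
  rw [analyticAt_iff_eventually_differentiableAt]
  have hregular : ∀ᶠ z in 𝓝 s, z ≠ 1 ∨ thetaConst κ = 0 := by
    rcases hs with hs | hs
    · exact (isOpen_ne.eventually_mem hs).mono fun _ ↦ .inl
    · exact .of_forall fun _ ↦ .inr (thetaConst_eq_zero hs)
  filter_upwards [hregular] with z hz
  exact ((differentiableAt_evenZeta γ hz).add (differentiable_oddZeta γ κ z)).div_const 2

lemma meromorphicOn_lerchZeta (γ κ : ℝ) : MeromorphicOn (lerchZeta γ κ) univ := fun s _ ↦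
  ((meromorphicAt_evenZeta γ κ s).add
    ((differentiable_oddZeta γ κ).analyticAt s).meromorphicAt).div (MeromorphicAt.const 2 s)

theorem lerchZeta_functional_equation {γ : ℝ} (κ : ℝ) {r : ℂ} (hr : ∀ n : ℕ, r ≠ n + 1)
    (hr₀ : r ≠ 0 ∨ ∀ m : ℤ, γ ≠ m) :
    lerchZeta γ κ r = e ((γ * κ : ℝ) : ℂ) * (Gamma (1 - r) / ((2 * π : ℝ) : ℂ) ^ (1 - r)) *
      (cexp (π * I * (1 - r) / 2) * lerchZeta κ (-γ) (1 - r) +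
        cexp (-(π * I * (1 - r) / 2)) * lerchZeta (-κ) γ (1 - r)) := by
  have heven : evenZeta κ (-γ) (1 - r) = evenZeta (-κ) γ (1 - r) := by
    rw [← evenZeta_neg_neg, neg_neg]
  have hodd : oddZeta κ (-γ) (1 - r) = -oddZeta (-κ) γ (1 - r) := by
    rw [← oddZeta_neg_neg, neg_neg]
  rw [show π * I * (1 - r) / 2 = π * (1 - r) / 2 * I by ring, ← neg_mul, Complex.exp_mul_I,
    Complex.exp_mul_I, Complex.cos_neg, Complex.sin_neg, lerchZeta, lerchZeta, lerchZeta, heven,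
    hodd, evenZeta_functional_equation κ hr (hr₀.imp_right thetaConst_eq_zero),
    oddZeta_functional_equation γ κ hr, Gammaℂ_def, cpow_neg]
  push_cast
  ring

lemma isLerchPsi_toMeromorphicNFOn (γ κ : ℝ) :
    IsLerchPsi γ κ (toMeromorphicNFOn (lerchZeta γ κ) univ) where
  meromorphic := meromorphicNFOn_toMeromorphicNFOn _ _
  hasSum r hr := by
    have hr₁ : r ≠ 1 := by
      rintro rfl
      exact lt_irrefl _ hr
    rw [toMeromorphicNFOn_eq_toMeromorphicNFAt (meromorphicOn_lerchZeta γ κ) (mem_univ r),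
      toMeromorphicNFAt_eq_self.mpr (analyticAt_lerchZeta γ (.inl hr₁)).meromorphicNFAt]
    exact hasSum_lerchZeta γ κ hr

lemma IsLerchPsi.unique {γ κ : ℝ} {f g : ℂ → ℂ} (hf : IsLerchPsi γ κ f)
    (hg : IsLerchPsi γ κ g) : f = g := by
  have hhalfPlane : ∀ᶠ s : ℂ in 𝓝 2, 1 < s.re :=
    continuous_re.continuousAt.eventually_const_lt (by norm_num)
  have hfg : f =ᶠ[𝓝 2] g :=
    hhalfPlane.mono fun s hs ↦ (hf.hasSum s hs).unique (hg.hasSum s hs)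
  exact (eqOn_univ f g).mp <| eqOn_of_meromorphicNFOn_of_eventuallyEq_nhdsNE hf.meromorphic
    hg.meromorphic isPreconnected_univ (mem_univ 2) (hfg.filter_mono nhdsWithin_le_nhds)

theorem isLerchPsi_lerchPsi (γ κ : ℝ) : IsLerchPsi γ κ (fun r ↦ lerchPsi r γ κ) :=
  Classical.epsilon_spec ⟨_, isLerchPsi_toMeromorphicNFOn γ κ⟩

lemma lerchPsi_eventuallyEq_lerchZeta (γ : ℝ) {κ : ℝ} {r : ℂ} (hr : r ≠ 1 ∨ ∀ m : ℤ, κ ≠ m) :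
    (fun r ↦ lerchPsi r γ κ) =ᶠ[𝓝 r] lerchZeta γ κ := by
  rw [(isLerchPsi_lerchPsi γ κ).unique (isLerchPsi_toMeromorphicNFOn γ κ)]
  refine (toMeromorphicNFOn_eq_toMeromorphicNFAt_on_nhds (meromorphicOn_lerchZeta γ κ)
    (mem_univ r)).trans ?_
  rw [toMeromorphicNFAt_eq_self.mpr (analyticAt_lerchZeta γ hr).meromorphicNFAt]

lemma lerchPsi_eq_lerchZeta (γ : ℝ) {κ : ℝ} {r : ℂ} (hr : r ≠ 1 ∨ ∀ m : ℤ, κ ≠ m) :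
    lerchPsi r γ κ = lerchZeta γ κ r :=
  (lerchPsi_eventuallyEq_lerchZeta γ hr).eq_of_nhds

theorem analyticAt_lerchPsi (γ : ℝ) {κ : ℝ} {r : ℂ} (hr : r ≠ 1 ∨ ∀ m : ℤ, κ ≠ m) :
    AnalyticAt ℂ (fun r ↦ lerchPsi r γ κ) r :=
  (analyticAt_lerchZeta γ hr).congr (lerchPsi_eventuallyEq_lerchZeta γ hr).symm

theorem lerchPsi_functional_equation {γ : ℝ} (κ : ℝ) {r : ℂ} (hr : ∀ n : ℕ, r ≠ n + 1)
    (hr₀ : r ≠ 0 ∨ ∀ m : ℤ, γ ≠ m) :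
    lerchPsi r γ κ = e ((γ * κ : ℝ) : ℂ) * (Gamma (1 - r) / ((2 * π : ℝ) : ℂ) ^ (1 - r)) *
      (cexp (π * I * (1 - r) / 2) * lerchPsi (1 - r) κ (-γ) +
        cexp (-(π * I * (1 - r) / 2)) * lerchPsi (1 - r) (-κ) γ) := by
  have hr₁ : r ≠ 1 := by simpa using hr 0
  have hγ : 1 - r ≠ 1 ∨ ∀ m : ℤ, γ ≠ m := by simpa using hr₀
  have hγ_neg : 1 - r ≠ 1 ∨ ∀ m : ℤ, -γ ≠ m :=
    hγ.imp_right fun h m hm ↦ h (-m) (by rw [Int.cast_neg, ← hm, neg_neg])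
  rw [lerchPsi_eq_lerchZeta γ (.inl hr₁), lerchPsi_eq_lerchZeta κ hγ_neg,
    lerchPsi_eq_lerchZeta (-κ) hγ, lerchZeta_functional_equation κ hr hr₀]

end LerchZeta

end

/-- For all real `γ`, `κ`: the function `r ↦ ψ(r, γ, κ)` is the meromorphic continuation of its
series, with no pole except possibly `r = 1` when `κ` is an integer. The functional equation holds
at every point `r` at which the factors on its right-hand side are all finite (`Γ(1 - r)` has its
poles at `r = 1, 2, …`, and `ψ(1 - r, κ, -γ)`, `ψ(1 - r, -κ, γ)` have theirs at `r = 0` when `γ` is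
an integer), and at the other points, in the limit, wherever the left-hand side is finite. -/
theorem proposition1 (γ κ : ℝ) :
    LerchZeta.IsLerchPsi γ κ (fun r => LerchZeta.lerchPsi r γ κ) ∧
    (∀ r : ℂ, (r ≠ 1 ∨ ∀ m : ℤ, κ ≠ m) →
      AnalyticAt ℂ (fun r => LerchZeta.lerchPsi r γ κ) r) ∧
    (∀ r : ℂ, (∀ n : ℕ, r ≠ n + 1) → (r ≠ 0 ∨ ∀ m : ℤ, γ ≠ m) →
      LerchZeta.lerchPsi r γ κ =
        LerchZeta.e ((γ * κ : ℝ) : ℂ) *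
          (Complex.Gamma (1 - r) / ((2 * Real.pi : ℝ) : ℂ) ^ (1 - r)) *
          (Complex.exp (Real.pi * Complex.I * (1 - r) / 2) *
              LerchZeta.lerchPsi (1 - r) κ (-γ) +
            Complex.exp (-(Real.pi * Complex.I * (1 - r) / 2)) *
              LerchZeta.lerchPsi (1 - r) (-κ) γ)) ∧
    (∀ r₀ : ℂ, (r₀ ≠ 1 ∨ ∀ m : ℤ, κ ≠ m) →
      Tendsto (fun r : ℂ =>
        LerchZeta.e ((γ * κ : ℝ) : ℂ) *
          (Complex.Gamma (1 - r) / ((2 * Real.pi : ℝ) : ℂ) ^ (1 - r)) *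
          (Complex.exp (Real.pi * Complex.I * (1 - r) / 2) *
              LerchZeta.lerchPsi (1 - r) κ (-γ) +
            Complex.exp (-(Real.pi * Complex.I * (1 - r) / 2)) *
              LerchZeta.lerchPsi (1 - r) (-κ) γ))
        (𝓝[≠] r₀) (𝓝 (LerchZeta.lerchPsi r₀ γ κ))) := by
  refine ⟨LerchZeta.isLerchPsi_lerchPsi γ κ, fun r hr ↦ LerchZeta.analyticAt_lerchPsi γ hr,
    fun r hr hr₀ ↦ LerchZeta.lerchPsi_functional_equation κ hr hr₀, fun r₀ hr₀ ↦ ?_⟩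
  have hcont := (LerchZeta.analyticAt_lerchPsi γ hr₀).continuousAt.tendsto
  refine (hcont.mono_left nhdsWithin_le_nhds).congr' ?_
  filter_upwards [LerchZeta.eventually_nhdsNE_forall_ne_intCast r₀] with r hr
  exact LerchZeta.lerchPsi_functional_equation κ (fun n ↦ by exact_mod_cast hr (n + 1))
    (.inl (by exact_mod_cast hr 0))
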